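/- Let $\mathbb F_q$ be the finite field with $q$ elements, let $n,t\ge 0$ be integers, and let $C\le\mathbb F_q^n$ be a linear code (a linear subspace). For $x\in\mathbb F_q^n$ let $\sigma(x)=\{j : x_j\ne 0\}$ be its Hamming support and $|\sigma(x)|$ its weight. Let $d$ be the minimum distance of $C$, i.e. the least weight of a nonzero codeword, with the convention $d=n+1$ if $C=\{0\}$, and let $W_i(C)$ be the number of codewords of weight $i$. Suppose that (a) $C$ is minimal: for all $v,w\in C$ with $\sigma(w)\subseteq\sigma(v)$ there is $\lambda\in\mathbb F_q$ with $w=\lambda v$; (b) $C$ is $t$-intersecting: $|\sigma(v)\cap\sigma(w)|\ge t$ for all $v,w\in C\setminus\{0\}$; (c) $d\le t-1+\frac{n}{t+1}$. Then $$W_i(C)\le (q-1)\binom{n-t}{i-t}\qquad\text{for every integer } i \text{ with } d\le i\le t-1+\left\lfloor\frac{n}{t+1}\right\rfloor .$$ (If $C\ne\{0\}$, then $t\le d\le i$ and $t\le n$, so the binomial coefficient is an ordinary one. If $C=\{0\}$, then $i\ge n+1$, so $W_i(C)=0$ and the inequality only says that the right-hand side is nonnegative; there negative differences $n-t$, $i-t$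 may be read as $0$.) -/

import Mathlib

/-- The Hamming support of a vector `x ∈ Fⁿ`: the set of coordinates where `x` is nonzero.
The Hamming weight, its cardinality, is Mathlib's `hammingNorm x`. -/
def hammingSupport {F : Type*} [Zero F] [DecidableEq F] {n : ℕ} (x : Fin n → F) :
    Finset (Fin n) :=
  Finset.univ.filter fun j => x j ≠ 0

/-- The weight of a vector is the size of its support. -/
theorem card_hammingSupport {F : Type*} [Zero F] [DecidableEq F] {n : ℕ} (x : Fin n → F) :
    (hammingSupport x).card = hammingNorm x := rfl

open Classical in
/-- The minimum distance of a linear code: the least weight of a nonzero codeword, where the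
zero code has minimum distance `n + 1` by convention. -/
noncomputable def minDistance {F : Type*} [Field F] [DecidableEq F] {n : ℕ}
    (C : Submodule F (Fin n → F)) : ℕ :=
  if C = ⊥ then n + 1 else sInf {w : ℕ | ∃ x ∈ C, x ≠ 0 ∧ hammingNorm x = w}

/-- A linear code is `t`-intersecting if the supports of any two (possibly equal) nonzero
codewords meet in at least `t` coordinates. -/
def IsTIntersectingCode {F : Type*} [Field F] [DecidableEq F] {n : ℕ} (t : ℕ)
    (C : Submodule F (Fin n → F)) : Prop :=
  ∀ v ∈ C, ∀ w ∈ C, v ≠ 0 → w ≠ 0 → t ≤ (hammingSupport v ∩ hammingSupport w).card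

/-- `v` is a minimal codeword of `C`: every codeword whose support is contained in that of `v`
is a scalar multiple of `v`. -/
def IsMinimalCodeword {F : Type*} [Field F] [DecidableEq F] {n : ℕ}
    (C : Submodule F (Fin n → F)) (v : Fin n → F) : Prop :=
  v ∈ C ∧ ∀ w ∈ C, hammingSupport w ⊆ hammingSupport v → ∃ c : F, w = c • v

/-- A linear code is minimal if all of its codewords are minimal. -/
def IsMinimalCode {F : Type*} [Field F] [DecidableEq F] {n : ℕ}
    (C : Submodule F (Fin n → F)) : Prop :=
  ∀ v ∈ C, IsMinimalCodeword C v

/-- `weightCount C i` is the number `W_i(C)` of codewords of weight `i`. -/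
noncomputable def weightCount {F : Type*} [Field F] [DecidableEq F] {n : ℕ}
    (C : Submodule F (Fin n → F)) (i : ℕ) : ℕ :=
  Set.ncard {x : Fin n → F | x ∈ C ∧ hammingNorm x = i}

/-! ### Numerical inequalities -/

/-! For `t = 0`, count supports: by minimality each carries at most `q - 1` codewords. For `t ≥ 1`
the bound is cruder: with `k = dim C`, `W_i ≤ q^k - 1 = (q-1)(1 + q + ... + q^(k-1))`. Put `i = t +
m`; the floor condition gives `n - t ≥ (t+1)m + 1`, so it suffices that the geometric sum is at most
`((t+1)m + 1).choose m`. If `k ≥ 2` and a word of weight `i` exists, minimality forces `(q-1)(k-1) <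
t + m`, by a polynomial degree argument, and intersection forces `t ≤ (q-1)m`, by averaging over a
line. These two inequalities make the rest purely numerical (`geomSum_le_choose_of_le`). -/

theorem geomSum_le_choose (a m : ℕ) (ha : 1 ≤ a) (hm : 1 ≤ m) :
    ∑ j ∈ Finset.range (m + 1), a ^ j ≤ (a * m + 1).choose m := by
  induction m, hm using Nat.le_induction with
  | base => simp [Finset.sum_range_succ]; omega
  | succ m hm ih =>
    have h1 : ∑ j ∈ Finset.range (m + 1 + 1), a ^ j
        = a * ∑ j ∈ Finset.range (m + 1), a ^ j + 1 := by
      rw [Finset.sum_range_succ', Finset.mul_sum]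
      simp [pow_succ, mul_comm]
    -- Vandermonde, keeping only the terms that choose at most one of the `a` new elements.
    have h2 : a * (a * m + 1).choose m + (a * m + 1).choose (m + 1)
        ≤ (a * (m + 1) + 1).choose (m + 1) := by
      have e : a * (m + 1) + 1 = (a * m + 1) + a := by ring
      rw [e, Nat.add_choose_eq (a * m + 1) a (m + 1), Finset.Nat.sum_antidiagonal_eq_sum_range_succ_mk,
        Finset.sum_range_succ, Finset.sum_range_succ]
      simp only [Nat.sub_self, Nat.choose_zero_right, mul_one, Nat.add_sub_cancel_left,
        Nat.choose_one_right]
      rw [mul_comm a]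
      omega
    have h3 : 0 < (a * m + 1).choose (m + 1) := Nat.choose_pos (by nlinarith)
    rw [h1]
    nlinarith

theorem one_add_pow_le_one_add_pow {t r : ℕ} (htr : t ≤ r) :
    (1 + r) ^ t ≤ (1 + t) ^ r := by
  induction r, htr using Nat.le_induction with
  | base => rfl
  | succ r htr ih =>
    have hr : 0 < (1 + r) ^ t := by positivity
    have key : (1 + (r + 1)) ^ t ≤ (1 + t) * (1 + r) ^ t := by
      have h : ((1 + (r + 1) : ℕ) : ℝ) ^ t ≤ (1 + t) * (1 + r : ℝ) ^ t := by
        have hpos : (0 : ℝ) < 1 + r := by positivity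
        have ht' : (t : ℝ) ≤ r := by exact_mod_cast htr
        have h1 : (1 + 1 / (1 + r) : ℝ) ^ t ≤ 1 + t := by
          have hstep : ∀ s : ℕ, s ≤ t → (1 + 1 / (1 + r) : ℝ) ^ s ≤ 1 + s := by
            intro s
            induction s with
            | zero => simp
            | succ s ihs =>
              intro hs
              have := ihs (by omega)
              have hs' : (s : ℝ) + 1 ≤ r := by
                have : s + 1 ≤ r := by omega
                exact_mod_cast this
              rw [pow_succ]
              calc _ ≤ (1 + s : ℝ) * (1 + 1 / (1 + r)) := by gcongr
                _ = 1 + s + (1 + s) / (1 + r) := by ring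
                _ ≤ 1 + s + 1 := by
                  gcongr
                  rw [div_le_one hpos]; linarith
                _ = _ := by push_cast; ring
          exact hstep t le_rfl
        have h2 : ((1 + (r + 1) : ℕ) : ℝ) = (1 + 1 / (1 + r)) * (1 + r) := by
          push_cast; field_simp; ring
        rw [h2, mul_pow]
        gcongr
      exact_mod_cast h
    calc _ ≤ (1 + t) * (1 + r) ^ t := key
      _ ≤ (1 + t) * (1 + t) ^ r := by gcongr
      _ = _ := by ring

theorem geomSum_le_geomSum_of_pow_le {t r K m : ℕ} (ht : 1 ≤ t) (htr : t ≤ r)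
    (h : (1 + r) ^ K ≤ (1 + t) ^ m) :
    ∑ j ∈ Finset.range (K + 1), (1 + r) ^ j ≤ ∑ j ∈ Finset.range (m + 1), (1 + t) ^ j := by
  have e1 : ∀ s N : ℕ, s * ∑ j ∈ Finset.range N, (1 + s) ^ j + 1 = (1 + s) ^ N := by
    intro s N
    induction N with
    | zero => simp
    | succ N ih => rw [Finset.sum_range_succ, pow_succ]; linear_combination ih
  have h1 := e1 r K
  have h2 := e1 t m
  rw [Finset.sum_range_succ, Finset.sum_range_succ]
  refine Nat.add_le_add ?_ h
  refine Nat.le_of_mul_le_mul_left (c := t) ?_ ht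
  calc _ ≤ r * ∑ j ∈ Finset.range K, (1 + r) ^ j := by gcongr
    _ ≤ _ := by omega

/-- Here `r = q - 1` and `K = k - 1`. The binomial dominates the geometric sum in `t + 1` up to
exponent `m`. If `t ≤ r`, comparing top powers suffices; if `r ≤ t` and `K ≤ m`, compare termwise;
if `K > m`, bound the left sum by twice its top power, except when `r = 1`, `t = 2`. -/
theorem geomSum_le_choose_of_le {r K t m : ℕ} (hr : 1 ≤ r) (ht : 1 ≤ t) (hm : 1 ≤ m)
    (htm : t ≤ r * m) (hK : r * K + 1 ≤ t + m) :
    ∑ j ∈ Finset.range (K + 1), (1 + r) ^ j ≤ ((t + 1) * m + 1).choose m := by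
  have hS := geomSum_le_choose (1 + t) m (by omega) hm
  rw [add_comm 1 t] at hS
  rw [add_comm 1 r]
  have htop : (t + 1) ^ m ≤ ∑ j ∈ Finset.range (m + 1), (t + 1) ^ j := by
    rw [Finset.sum_range_succ]; omega
  have hq : ∑ j ∈ Finset.range (K + 1), (r + 1) ^ j < 2 * (r + 1) ^ K := by
    have := Nat.geomSum_lt (m := r + 1) (n := K) (s := Finset.range K) (by omega)
      (fun k hk => Finset.mem_range.1 hk)
    rw [Finset.sum_range_succ]; omega
  rcases le_total t r with htr | hrt
  · refine le_trans ?_ hS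
    rw [add_comm r 1, add_comm t 1]
    refine geomSum_le_geomSum_of_pow_le ht htr ?_
    have h1 : ((1 + r) ^ K) ^ t ≤ ((1 + t) ^ m) ^ t := by
      calc ((1 + r) ^ K) ^ t = ((1 + r) ^ t) ^ K := by rw [← pow_mul, ← pow_mul, mul_comm]
        _ ≤ ((1 + t) ^ r) ^ K := Nat.pow_le_pow_left (one_add_pow_le_one_add_pow htr) K
        _ = (1 + t) ^ (r * K) := by rw [← pow_mul]
        _ ≤ (1 + t) ^ (m * t) := by
          -- `r * K ≤ t + m - 1 ≤ t * m`, the last step being `(t-1)(m-1) ≥ 0`.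
          apply Nat.pow_le_pow_right (by omega)
          obtain ⟨a, rfl⟩ := Nat.exists_eq_add_of_le ht
          obtain ⟨b, rfl⟩ := Nat.exists_eq_add_of_le hm
          nlinarith [Nat.zero_le (a * b)]
        _ = _ := by rw [← pow_mul]
    exact (Nat.pow_le_pow_iff_left (by omega)).1 h1
  rcases le_or_gt K m with hKm | hKm
  · refine le_trans ?_ hS
    calc _ ≤ ∑ j ∈ Finset.range (m + 1), (r + 1) ^ j :=
          Finset.sum_le_sum_of_subset (Finset.range_mono (by omega))
      _ ≤ _ := Finset.sum_le_sum fun j _ => Nat.pow_le_pow_left (by omega) j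
  obtain ⟨e, rfl⟩ := Nat.exists_eq_add_of_lt hKm
  rcases Nat.lt_or_ge r 2 with hr2 | hr2
  · obtain rfl : r = 1 := by omega
    rcases Nat.lt_or_ge t 3 with ht3 | ht3
    · obtain rfl : t = 2 := by omega
      obtain rfl : e = 0 := by omega
      rcases Nat.lt_or_ge m 3 with hm3 | hm3
      -- The geometric sum in `t + 1` is too small here (`13 < 15`), but the binomial is `21`.
      · obtain rfl : m = 2 := by omega
        decide
      · refine le_trans ?_ hS
        clear hS htop hq htm hK hKm
        induction m, hm3 using Nat.le_induction with
        | base => decide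
        | succ m hm3 ih =>
          rw [Finset.sum_range_succ, Finset.sum_range_succ (fun j => (2 + 1) ^ j)]
          have : (1 + 1) ^ (m + 1 + 0 + 1) ≤ (2 + 1) ^ (m + 1) := by
            clear ih
            induction m, hm3 using Nat.le_induction with
            | base => decide
            | succ m hm3 ih =>
              have h1 : (1 + 1) ^ (m + 1 + 1 + 0 + 1) = 2 * (1 + 1) ^ (m + 1 + 0 + 1) := by ring
              have h2 : (2 + 1) ^ (m + 1 + 1) = 3 * (2 + 1) ^ (m + 1) := by ring
              have := ih (by omega)
              omega
          exact Nat.add_le_add (ih (by omega)) this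
    · have h4 : 4 ^ m ≤ (t + 1) ^ m := Nat.pow_le_pow_left (by omega) m
      have h2 : 2 * (1 + 1) ^ (m + e + 1) ≤ 4 ^ m := by
        calc 2 * (1 + 1) ^ (m + e + 1) = 2 ^ (m + e + 2) := by ring
          _ ≤ 2 ^ (2 * m) := Nat.pow_le_pow_right (by omega) (by omega)
          _ = 4 ^ m := by rw [pow_mul]; norm_num
      omega
  · have hre : r * (e + 1) + 1 ≤ m := by nlinarith
    have hrm : r + 1 ≤ m := by nlinarith
    have hbase : 2 * (r + 1) ≤ t + 1 := by
      obtain ⟨s, rfl⟩ := Nat.exists_eq_add_of_le hr2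
      nlinarith
    have h2e : (r + 1) ^ (e + 1) ≤ 2 ^ (r * (e + 1)) := by
      rw [pow_mul]
      exact Nat.pow_le_pow_left (Nat.lt_two_pow_self) _
    have : 2 * (r + 1) ^ (m + e + 1) ≤ (t + 1) ^ m := by
      calc 2 * (r + 1) ^ (m + e + 1) = 2 * (r + 1) ^ (e + 1) * (r + 1) ^ m := by ring
        _ ≤ 2 * 2 ^ (r * (e + 1)) * (r + 1) ^ m := by gcongr
        _ = 2 ^ (r * (e + 1) + 1) * (r + 1) ^ m := by ring
        _ ≤ 2 ^ m * (r + 1) ^ m := by gcongr; omega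
        _ = (2 * (r + 1)) ^ m := by rw [mul_pow]
        _ ≤ _ := Nat.pow_le_pow_left hbase m
    omega

/-! ### Minimal codes -/

section Codes

variable {F : Type*} [Field F] [DecidableEq F] {n : ℕ}

theorem mem_hammingSupport {x : Fin n → F} {j : Fin n} : j ∈ hammingSupport x ↔ x j ≠ 0 := by
  simp [hammingSupport]

theorem minDistance_pos (C : Submodule F (Fin n → F)) : 0 < minDistance C := by
  unfold minDistance
  split_ifs with h
  · omega
  · obtain ⟨x, hx, hx0⟩ := Submodule.exists_mem_ne_zero_of_ne_bot h
    obtain ⟨y, -, hy0, hy⟩ := Nat.sInf_mem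
      (s := {w : ℕ | ∃ x ∈ C, x ≠ 0 ∧ hammingNorm x = w}) ⟨_, x, hx, hx0, rfl⟩
    rw [← hy]
    exact hammingNorm_pos_iff.2 hy0

variable [Fintype F]

/-- The weight of a nonzero codeword of a minimal code of dimension `k` is at least
`(q - 1) (k - 1) + 1`. -/
theorem IsMinimalCode.mul_finrank_sub_one_lt {C : Submodule F (Fin n → F)}
    (hmin : IsMinimalCode C) {v : Fin n → F} (hv : v ∈ C) (hv0 : v ≠ 0) :
    (Fintype.card F - 1) * (Module.finrank F C - 1) < hammingNorm v := by
  obtain ⟨j₀, hj₀⟩ : ∃ j, v j ≠ 0 := Function.ne_iff.1 hv0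
  let f : (Fin n → F) →ₗ[F] F := LinearMap.proj j₀
  let W : Submodule F (Fin n → F) := C ⊓ LinearMap.ker f
  let b := Module.finBasis F W
  set K := Module.finrank F W
  have hK : Module.finrank F C - 1 ≤ K := by
    have h1 := LinearMap.finrank_range_add_finrank_ker f
    have h2 : Module.finrank F (LinearMap.range f) ≤ 1 := by
      simpa using Submodule.finrank_le (LinearMap.range f)
    have h3 := Submodule.finrank_sup_add_finrank_inf_eq C (LinearMap.ker f)
    have h4 := Submodule.finrank_le (C ⊔ LinearMap.ker f)
    change _ + K = _ at h3
    omega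
  -- `P` is nonzero at `x` exactly when the word `w ∈ W` with coordinates `x` agrees with `v`
  -- nowhere on its support. Then `v - w` covers the support of `v`, and minimality forces `w = 0`.
  let P : MvPolynomial (Fin K) F := ∏ j ∈ (hammingSupport v).erase j₀,
    (1 - ∑ l, MvPolynomial.C ((b l : Fin n → F) j / v j) * MvPolynomial.X l)
  have hcard : ((hammingSupport v).erase j₀).card + 1 = hammingNorm v := by
    rw [Finset.card_erase_add_one (mem_hammingSupport.2 hj₀), card_hammingSupport]
  have hdeg : P.totalDegree ≤ ((hammingSupport v).erase j₀).card := by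
    refine (MvPolynomial.totalDegree_finsetProd _ _).trans ?_
    rw [Finset.card_eq_sum_ones]
    refine Finset.sum_le_sum fun j _ => ?_
    refine (MvPolynomial.totalDegree_sub _ _).trans (max_le (by simp) ?_)
    refine MvPolynomial.totalDegree_finsetSum_le fun l _ => ?_
    refine (MvPolynomial.totalDegree_mul _ _).trans ?_
    simp
  have heval : ∀ x : Fin K → F, MvPolynomial.eval x P = ∏ j ∈ (hammingSupport v).erase j₀,
      (1 - ((∑ l, x l • b l : W) : Fin n → F) j / v j) := by
    intro x
    simp only [P, map_prod, map_sub, map_one, map_sum, map_mul, MvPolynomial.eval_C,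
      MvPolynomial.eval_X]
    refine Finset.prod_congr rfl fun j _ => ?_
    congr 1
    simp only [Submodule.coe_sum, Submodule.coe_smul, Finset.sum_apply, Pi.smul_apply,
      smul_eq_mul, Finset.sum_div]
    exact Finset.sum_congr rfl fun l _ => by ring
  have hzero : ∀ x : Fin K → F, x ≠ 0 → MvPolynomial.eval x P = 0 := by
    intro x hx
    by_contra hne
    rw [heval, ← ne_eq, Finset.prod_ne_zero_iff] at hne
    set w := ∑ l, x l • b l with hw
    have hwj₀ : (w : Fin n → F) j₀ = 0 := LinearMap.mem_ker.1 w.2.2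
    have hsub : v - (w : Fin n → F) ∈ C := C.sub_mem hv w.2.1
    obtain ⟨c, hc⟩ := (hmin _ hsub).2 v hv (by
      intro j hj
      rw [mem_hammingSupport] at hj ⊢
      by_cases hjj : j = j₀
      · subst hjj
        simpa [hwj₀] using hj
      · have := hne j (Finset.mem_erase.2 ⟨hjj, mem_hammingSupport.2 hj⟩)
        intro h0
        apply this
        rw [Pi.sub_apply, sub_eq_zero] at h0
        rw [← h0, div_self hj, sub_self])
    have hc1 : c = 1 := by
      have := congrFun hc j₀
      simp only [Pi.smul_apply, Pi.sub_apply, hwj₀, sub_zero, smul_eq_mul] at this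
      exact mul_right_cancel₀ hj₀ (by rw [← this, one_mul])
    rw [hc1, one_smul, eq_comm, sub_eq_self] at hc
    have hw0 : w = 0 := Subtype.ext hc
    exact hx (funext (Fintype.linearIndependent_iff.1 b.linearIndependent x hw0))
  have hone : MvPolynomial.eval 0 P = 1 := by
    rw [heval]
    simp
  have hsum : ∑ x, MvPolynomial.eval x P = 1 := by
    rw [Fintype.sum_eq_single 0 hzero, hone]
  -- As in Chevalley–Warning, a polynomial of smaller degree has values summing to `0`.
  have hlow : (Fintype.card F - 1) * K ≤ P.totalDegree := by
    by_contra! hlt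
    have := MvPolynomial.sum_eval_eq_zero P (by simpa using hlt)
    exact one_ne_zero (hsum.symm.trans this)
  have := Nat.mul_le_mul_left (Fintype.card F - 1) hK
  omega

/-- In a `t`-intersecting code, averaging over a line through `w` in the direction `v`. -/
theorem IsTIntersectingCode.mul_card_le {t : ℕ} {C : Submodule F (Fin n → F)}
    (hint : IsTIntersectingCode t C) {v w : Fin n → F} (hv : v ∈ C) (hv0 : v ≠ 0)
    (hw : w ∈ C) (hvw : ∀ c : F, w ≠ c • v) :
    Fintype.card F * t ≤ (Fintype.card F - 1) * hammingNorm v := by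
  have h1 : ∀ c : F, t ≤ ((hammingSupport v).filter fun j => w j ≠ c * v j).card := by
    intro c
    refine (hint v hv (w - c • v) (C.sub_mem hw (C.smul_mem c hv)) hv0
      (sub_ne_zero.2 (hvw c))).trans (Finset.card_le_card fun j hj => ?_)
    rw [Finset.mem_inter, mem_hammingSupport (x := w - c • v)] at hj
    exact Finset.mem_filter.2 ⟨hj.1, by simpa [sub_eq_zero] using hj.2⟩
  calc Fintype.card F * t = ∑ _c : F, t := by simp
    _ ≤ ∑ c : F, ((hammingSupport v).filter fun j => w j ≠ c * v j).card :=
      Finset.sum_le_sum fun c _ => h1 c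
    -- Double counting: each `j` in the support of `v` excludes only `c = w j / v j`.
    _ = ∑ j ∈ hammingSupport v, (Finset.univ.filter fun c : F => w j ≠ c * v j).card := by
      simp only [Finset.card_filter]
      exact Finset.sum_comm
    _ ≤ ∑ j ∈ hammingSupport v, (Fintype.card F - 1) := by
      refine Finset.sum_le_sum fun j hj => ?_
      have hj0 := mem_hammingSupport.1 hj
      have : (Finset.univ.filter fun c : F => w j ≠ c * v j) ⊆
          Finset.univ.erase (w j / v j) := by
        intro c hc
        refine Finset.mem_erase.2 ⟨?_, Finset.mem_univ _⟩
        rintro rfl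
        exact (Finset.mem_filter.1 hc).2 (div_mul_cancel₀ _ hj0).symm
      refine (Finset.card_le_card this).trans ?_
      rw [Finset.card_erase_of_mem (Finset.mem_univ _), Finset.card_univ]
    _ = (Fintype.card F - 1) * hammingNorm v := by
      rw [Finset.sum_const, card_hammingSupport, smul_eq_mul, mul_comm]

open Classical in
/-- In a minimal code each support carries at most `q - 1` codewords. -/
theorem IsMinimalCode.weightCount_le_choose {C : Submodule F (Fin n → F)}
    (hmin : IsMinimalCode C) {i : ℕ} (hi : 0 < i) :
    weightCount C i ≤ (Fintype.card F - 1) * n.choose i := by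
  let S : Finset (Fin n → F) := Finset.univ.filter fun x => x ∈ C ∧ hammingNorm x = i
  have hS : weightCount C i = S.card := by
    rw [weightCount, ← Set.ncard_coe_finset]
    simp [S]
  have hmaps : ∀ x ∈ S, hammingSupport x ∈ (Finset.univ : Finset (Fin n)).powersetCard i := by
    intro x hx
    rw [Finset.mem_powersetCard]
    exact ⟨Finset.subset_univ _, (Finset.mem_filter.1 hx).2.2⟩
  rw [hS]
  refine (Finset.card_le_mul_card_image_of_maps_to hmaps (Fintype.card F - 1) ?_).trans ?_
  · intro s hs
    rcases (S.filter fun x => hammingSupport x = s).eq_empty_or_nonempty with h | ⟨x, hx⟩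
    · rw [h]; simp
    · have hsub : (S.filter fun y => hammingSupport y = s) ⊆
          ((Finset.univ : Finset F).erase 0).image fun c => c • x := by
        intro y hy
        simp only [S, Finset.mem_filter, Finset.mem_univ, true_and] at hx hy
        obtain ⟨c, hc⟩ := (hmin x hx.1.1).2 y hy.1.1 (by rw [hx.2, hy.2])
        refine Finset.mem_image.2 ⟨c, Finset.mem_erase.2 ⟨?_, Finset.mem_univ _⟩, hc.symm⟩
        rintro rfl
        have := hy.1.2
        rw [hc, zero_smul, hammingNorm_zero] at this
        omega
      refine (Finset.card_le_card hsub).trans (Finset.card_image_le.trans ?_)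
      rw [Finset.card_erase_of_mem (Finset.mem_univ _), Finset.card_univ]
  · rw [Finset.card_powersetCard, Finset.card_univ, Fintype.card_fin]

open Classical in
theorem weightCount_le_card_pow_sub_one (C : Submodule F (Fin n → F)) {i : ℕ} (hi : 0 < i) :
    weightCount C i ≤ Fintype.card F ^ Module.finrank F C - 1 := by
  have h1 : {x : Fin n → F | x ∈ C ∧ hammingNorm x = i} ⊆ (C : Set (Fin n → F)) \ {0} := by
    rintro x ⟨hx, hxi⟩
    refine ⟨hx, ?_⟩
    rintro rfl
    rw [hammingNorm_zero] at hxi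
    omega
  refine (Set.ncard_le_ncard h1 (Set.toFinite _)).trans ?_
  rw [Set.ncard_sdiff_singleton_of_mem C.zero_mem]
  have : (C : Set (Fin n → F)).ncard = Fintype.card F ^ Module.finrank F C := by
    rw [← Module.card_eq_pow_finrank (K := F) (V := C), ← Nat.card_eq_fintype_card]
    rfl
  rw [this]

end Codes

/-! ### The weight bound from the dimension and intersection constraints -/

theorem mainTheorem8 {F : Type*} [Field F] [Fintype F] [DecidableEq F] (n t : ℕ)
    (C : Submodule F (Fin n → F)) (hmin : IsMinimalCode C) (hint : IsTIntersectingCode t C)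
    (hd : (minDistance C : ℚ) ≤ (t : ℚ) - 1 + (n : ℚ) / ((t : ℚ) + 1))
    (i : ℕ) (hdi : minDistance C ≤ i)
    (hi : (i : ℤ) ≤ (t : ℤ) - 1 + ⌊(n : ℚ) / ((t : ℚ) + 1)⌋) :
    weightCount C i ≤ (Fintype.card F - 1) * (n - t).choose (i - t) := by
  have hi0 : 0 < i := (minDistance_pos C).trans_le hdi
  have hq : 1 < Fintype.card F := Fintype.one_lt_card
  rcases Set.eq_empty_or_nonempty {x : Fin n → F | x ∈ C ∧ hammingNorm x = i} with h | ⟨v, hv, hvi⟩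
  · rw [weightCount, h, Set.ncard_empty]; exact Nat.zero_le _
  rcases Nat.eq_zero_or_pos t with rfl | ht
  · simpa using hmin.weightCount_le_choose hi0
  have hv0 : v ≠ 0 := by
    rintro rfl
    rw [hammingNorm_zero] at hvi
    omega
  have hti : t ≤ i := by
    have := hint v hv v hv hv0 hv0
    rwa [Finset.inter_self, card_hammingSupport, hvi] at this
  obtain ⟨m, rfl⟩ := Nat.exists_eq_add_of_le hti
  have hn : (t + 1) * (m + 1) ≤ n := by
    have h1 : ((m + 1 : ℤ)) ≤ ⌊(n : ℚ) / ((t : ℚ) + 1)⌋ := by push_cast at hi; linarith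
    rw [Int.le_floor, le_div_iff₀ (by positivity)] at h1
    push_cast at h1
    have h2 : ((m : ℚ) + 1) * (t + 1) ≤ n := h1
    have h3 : (m + 1) * (t + 1) ≤ n := by exact_mod_cast h2
    rwa [mul_comm]
  have hnt : (t + 1) * m + 1 ≤ n - t := by
    have : (t + 1) * (m + 1) = (t + 1) * m + t + 1 := by ring
    omega
  rw [Nat.add_sub_cancel_left]
  refine (weightCount_le_card_pow_sub_one C hi0).trans ?_
  obtain ⟨r, hr⟩ : ∃ r, Fintype.card F = 1 + r := Nat.exists_eq_add_of_le hq.le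
  have hgeom : ∀ N : ℕ, (1 + r) ^ N - 1 = r * ∑ j ∈ Finset.range N, (1 + r) ^ j := by
    intro N
    have := Nat.geomSum_eq (m := 1 + r) (by omega) N
    rw [this, Nat.add_sub_cancel_left, Nat.mul_div_cancel']
    simpa using Nat.sub_dvd_pow_sub_pow (1 + r) 1 N
  rw [hr, Nat.add_sub_cancel_left, hgeom]
  refine Nat.mul_le_mul_left r (le_trans ?_ (Nat.choose_le_choose m hnt))
  by_cases hk : ∃ w ∈ C, ∀ c : F, w ≠ c • v
  · obtain ⟨w, hw, hvw⟩ := hk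
    have hB := hint.mul_card_le hv hv0 hw hvw
    have hA := hmin.mul_finrank_sub_one_lt hv hv0
    rw [hr, hvi, Nat.add_sub_cancel_left] at hA hB
    -- `hB` reads `(1 + r) * t ≤ r * (t + m)`.
    have htm : t ≤ r * m := by nlinarith
    have hm : 1 ≤ m := by
      rcases Nat.eq_zero_or_pos m with rfl | h
      · omega
      · exact h
    have hpos : 0 < Module.finrank F C := by
      have : Nontrivial C := ⟨⟨v, hv⟩, 0, fun h => hv0 (congrArg Subtype.val h)⟩
      exact Module.finrank_pos
    have := geomSum_le_choose_of_le (K := Module.finrank F C - 1) (by omega) ht hm htm hA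
    rwa [Nat.sub_add_cancel hpos] at this
  · push Not at hk
    have hfr : Module.finrank F C ≤ 1 := by
      refine finrank_le_one (⟨v, hv⟩ : C) fun w => ?_
      obtain ⟨c, hc⟩ := hk w w.2
      exact ⟨c, Subtype.ext hc.symm⟩
    have hch : 0 < ((t + 1) * m + 1).choose m := Nat.choose_pos (by nlinarith)
    calc _ ≤ ∑ j ∈ Finset.range 1, (1 + r) ^ j :=
          Finset.sum_le_sum_of_subset (Finset.range_mono hfr)
      _ ≤ _ := by simpa using Nat.succ_le_of_lt hch
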